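/- **Notation.** For $A\in\mathbb R^{p\times n}$ with columns $a_1,\dots,a_n\ne0$ let $\mu(A)=\max_{i\ne j}\frac{|a_i^\top a_j|}{\|a_i\|_2\|a_j\|_2}$ be the mutual coherence and, for normalized columns, let $\tilde\mu(A)=\inf\{\max_{i\ne j}|w_i^\top a_j| : W\in\mathbb R^{p\times n},\ w_i^\top a_i=1\ \forall i\}$ be the generalized mutual coherence (both are $0$ if $n=1$). We read $1/0=+\infty$ in expressions $1/\mu$, $1/\tilde\mu$. A one-dimensional CNN of depth $\mathcal D$ with kernel size $s$, activation $\rho$ and input $y\in\mathbb R^{d_0}$ has layers $h_0=y$ (one channel) and $h_{l}(y)_q=\rho\big(\sum_{p}w^{(l)}_{q,p}*_{t_l}h_{l-1}(y)_p+b^{(l)}_q\mathbf 1\big)$, $l=1,\dots,\mathcal D$, with strides $t_l\ge1$, filters $w^{(l)}_{q,p}\in\mathbb R^s$ and biases $b_q^{(l)}\in\mathbb R$. Here, for a signal $x$ of length $n$, $w*_tx$ is the signal of length $\lceil n/t\rceil$ with entries $(w*_tx)_i=\sum_{k=1}^s w_kx_{(i-1)t+k}$, where $x$ is continued by zero. Its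 outputs $\tilde x_1,\dots,\tilde x_J$, $\tilde x_j\in\mathbb R^{d_j}$, are obtained from (possibly intermediate) layers $h_{l_j}$, $l_j\le\mathcal D$, by one further convolutional layer of kernel size $s$ without activation, with $d_j$ channels of length one. Its number of weights is the number of nonzero filter entries and biases, those of the output layers included. **Theorem.** There is an absolute constant $A>0$ such that the following holds. Let $d_0,\dots,d_J\ge1$, let $D_j\in\mathbb R^{d_{j-1}\times d_j}$ ($1\le j\le J$) have $\ell_2$-normalized columns, and let $\lambda\in\mathbb R^J$ satisfy $$\lambda_j<\tfrac12\Big(1+\frac1{\mu(D_j)}\Big),\qquad 1\le j\le J.$$ Then there is $c>0$ depending only on $(D_j)_j$ and $\lambda$, and for every $B\in\mathbb R^J$ there is $C>0$ depending only on $(D_j)_j$, $\lambda$ and $B$, with the following property. Let $\rho:\mathbb R\to\mathbb R$ be continuous with $\rho(x)=x$ for $x\ge0$, $|\rho(x)|\le\beta$ for $x<0$, and $|\rho(x)-\rho(y)|\le L|x-y|$ for $x,y\le0$. Let $m\ge1$ be an integer and, if $L<1$, assume moreover $$\lambda_j<\frac1{2-2L^m}\Big(\frac1{\tilde\mu(D_j)}-2L^md_j\Big),\qquad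 1\le j\le J.$$ Let $\delta\in\mathbb R^J$, and let $s\ge2$ and $K\ge1$ be integers. Then there is a CNN with activation $\rho$, kernel size $s$, depth at most $A\,mK\,\big\lceil\log_s\prod_{j=1}^J(d_{j-1}+d_j)\big\rceil$ and at most $A\,mK\prod_{j=1}^J(d_{j-1}+d_j)^2$ weights such that, for every observation $y\in\mathbb R^{d_0}$ and all $x_1,\dots,x_J$, $x_j\in\mathbb R^{d_j}$, which, with $x_0:=y$ and some tolerances $\varepsilon_j$, satisfy $$\|x_{j-1}-D_jx_j\|_2\le\varepsilon_j,\quad \|x_j\|_0\le\lambda_j,\quad \|x_j\|_\infty\le B_j,\quad \|x_{j-1}-D_jx_j\|_1\le\delta_j\qquad(1\le j\le J),$$ its outputs $\tilde x_1,\dots,\tilde x_J$ on the input $y$ satisfy $$\|\tilde x_j-x_j\|_2\le C e^{-cK}+C\sum_{i=1}^j\delta_i+C\,\beta L^{m-1},\qquad 1\le j\le J.$$ -/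

import Mathlib

open scoped Matrix

noncomputable section

namespace DeepSparseCoding

/-! ### Vectors and dictionaries -/

/-- The Euclidean norm `‖v‖₂`. -/
def l2norm {n : ℕ} (v : Fin n → ℝ) : ℝ := ‖WithLp.toLp 2 v‖

/-- The norm `‖v‖₁`. -/
def l1norm {n : ℕ} (v : Fin n → ℝ) : ℝ := ∑ i, |v i|

/-- The number of nonzero entries of a family; for vectors this is `‖v‖₀`. -/
def nnz {ι : Type} [Fintype ι] (v : ι → ℝ) : ℕ := {i | v i ≠ 0}.ncard

/-- Every column has Euclidean norm one. -/
def ColumnNormalized {p n : ℕ} (A : Matrix (Fin p) (Fin n) ℝ) : Prop :=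
  ∀ i, l2norm (Aᵀ i) = 1

/-- The mutual coherence `μ(A) = max_{i ≠ j} |aᵢᵀ aⱼ| / (‖aᵢ‖₂ ‖aⱼ‖₂)`
(it is `0` if there is at most one column). -/
def mutualCoherence {p n : ℕ} (A : Matrix (Fin p) (Fin n) ℝ) : ℝ :=
  ⨆ q : {q : Fin n × Fin n // q.1 ≠ q.2},
    |Aᵀ q.1.1 ⬝ᵥ Aᵀ q.1.2| / (l2norm (Aᵀ q.1.1) * l2norm (Aᵀ q.1.2))

/-- The generalized mutual coherence
`μ̃(A) = inf { max_{i ≠ j} |wᵢᵀ aⱼ| : wᵢᵀ aᵢ = 1 for all i }`, the infimum over matrices `W` of the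
shape of `A`. -/
def genMutualCoherence {p n : ℕ} (A : Matrix (Fin p) (Fin n) ℝ) : ℝ :=
  sInf {r : ℝ | ∃ W : Matrix (Fin p) (Fin n) ℝ, (∀ i, Wᵀ i ⬝ᵥ Aᵀ i = 1) ∧
    r = ⨆ q : {q : Fin n × Fin n // q.1 ≠ q.2}, |Wᵀ q.1.1 ⬝ᵥ Aᵀ q.1.2|}

/-! ### The deep sparse coding problem

A family `x : (j : Fin (J + 1)) → Fin (d j) → ℝ` holds the observation `y = x 0` together with the
codes `x 1, …, x J`.  The dictionary number `j + 1` is `D j`, of shape `d j × d (j + 1)`. -/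

/-- `x 1, …, x J` are sparse codings of `y = x 0` for the dictionaries `D`, the sparsity levels
`lam` and the tolerances `tol`:
`‖x_{j-1} - D_j x_j‖₂ ≤ tol_j` and `‖x_j‖₀ ≤ lam_j` for `j = 1, …, J`. -/
def IsDeepSparseCoding {J : ℕ} {d : Fin (J + 1) → ℕ}
    (D : (j : Fin J) → Matrix (Fin (d j.castSucc)) (Fin (d j.succ)) ℝ)
    (lam tol : Fin J → ℝ) (x : (j : Fin (J + 1)) → Fin (d j) → ℝ) : Prop :=
  ∀ j : Fin J, l2norm (x j.castSucc - D j *ᵥ x j.succ) ≤ tol j ∧ (nnz (x j.succ) : ℝ) ≤ lam j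

/-- Bounded codes and bounded noise: for `j = 1, …, J` the entries of `x_j` are at most `B_j` in
absolute value, and the noise `ε_j = x_{j-1} - D_j x_j` satisfies `‖ε_j‖₁ ≤ δ_j`. -/
def BoundedSignalAndNoise {J : ℕ} {d : Fin (J + 1) → ℕ}
    (D : (j : Fin J) → Matrix (Fin (d j.castSucc)) (Fin (d j.succ)) ℝ)
    (B δ : Fin J → ℝ) (x : (j : Fin (J + 1)) → Fin (d j) → ℝ) : Prop :=
  ∀ j : Fin J, (∀ i, |x j.succ i| ≤ B j) ∧ l1norm (x j.castSucc - D j *ᵥ x j.succ) ≤ δ j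

/-! ### Activation functions -/

/-- `ρ` is a generalized ReLU type activation function with bound `β` and Lipschitz constant `L`.
The Lipschitz condition is asked for on the half-line where `ρ` is not prescribed; it follows from
a Lipschitz condition on the whole line. -/
structure IsGeneralizedReLU (ρ : ℝ → ℝ) (β L : ℝ) : Prop where
  continuous : Continuous ρ
  eq_self : ∀ x, 0 ≤ x → ρ x = x
  bound : ∀ x, x < 0 → |ρ x| ≤ β
  lipschitz : ∀ x y, x ≤ 0 → y ≤ 0 → |ρ x - ρ y| ≤ L * |x - y|

/-! ### Multi-channel convolutional neural networks -/

/-- A finite signal continued by zero. -/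
def pad {d : ℕ} (x : Fin d → ℝ) (n : ℕ) : ℝ := if h : n < d then x ⟨n, h⟩ else 0

/-- The convolution of stride `t` of a filter of size `s` with a signal of length `d`, a signal of
length `⌈d / t⌉`; with indices counted from zero, `(w *ₜ x)ᵢ = ∑ₖ wₖ x_{i t + k}`. -/
def conv {s d : ℕ} (w : Fin s → ℝ) (t : ℕ) (x : Fin d → ℝ) : Fin (d ⌈/⌉ t) → ℝ :=
  fun i => ∑ k : Fin s, w k * pad x (i * t + k)

/-- The data of a multi-channel one-dimensional CNN with input length `d` in which all filters have
size `s`.  Layer `l + 1` has stride `stride l`, filters `filter l` and biases `bias l`; only the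
layers `1, …, depth` belong to the network, so the data with index `l ≥ depth` are irrelevant. -/
structure DCNN (s d : ℕ) where
  depth : ℕ
  stride : ℕ → ℕ
  channels : ℕ → ℕ
  filter : (l : ℕ) → Fin (channels (l + 1)) → Fin (channels l) → Fin s → ℝ
  bias : (l : ℕ) → Fin (channels (l + 1)) → ℝ
  stride_pos : ∀ l, 1 ≤ stride l
  channels_pos : ∀ l, 1 ≤ channels l
  channels_zero : channels 0 = 1

namespace DCNN

variable {s d : ℕ}

/-- The length of the signals in layer `l`: `d_0 = d` and `d_{l+1} = ⌈d_l / t_{l+1}⌉`. -/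
def size (N : DCNN s d) : ℕ → ℕ
  | 0 => d
  | l + 1 => N.size l ⌈/⌉ N.stride l

/-- The channels of layer `l` on the input `x`, when the activation function is `ρ`. -/
def hidden (N : DCNN s d) (ρ : ℝ → ℝ) (x : Fin d → ℝ) :
    (l : ℕ) → Fin (N.channels l) → Fin (N.size l) → ℝ
  | 0 => fun _ => x
  | l + 1 => fun q i =>
      ρ ((∑ p, conv (N.filter l q p) (N.stride l) (N.hidden ρ x l p) i) + N.bias l q)

/-- The number of nonzero filter entries and biases in the layers `1, …, depth`. -/
def hiddenWeights (N : DCNN s d) : ℕ :=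
  ∑ l ∈ Finset.range N.depth, ((∑ q, ∑ p, nnz (N.filter l q p)) + nnz (N.bias l))

end DCNN

/-- A CNN with `J` outputs, the `j`-th one a vector of length `e j`.  The `j`-th output is computed
from layer `tap j ≤ depth` by one more convolutional layer of filter size `s`, without activation,
with `e j` channels, and with a stride so large that each of its channels has length one (so the
stride does not matter). -/
structure MultiOutputCNN (s d : ℕ) {J : ℕ} (e : Fin J → ℕ) extends DCNN s d where
  tap : Fin J → ℕ
  tap_le : ∀ j, tap j ≤ depth
  outFilter : (j : Fin J) → Fin (e j) → Fin (channels (tap j)) → Fin s → ℝ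
  outBias : (j : Fin J) → Fin (e j) → ℝ

namespace MultiOutputCNN

variable {s d J : ℕ} {e : Fin J → ℕ}

/-- The `j`-th output on the input `y`, when the activation function is `ρ`. -/
def output (N : MultiOutputCNN s d e) (ρ : ℝ → ℝ) (y : Fin d → ℝ) (j : Fin J) : Fin (e j) → ℝ :=
  fun i => (∑ p, ∑ k : Fin s,
    N.outFilter j i p k * pad (N.toDCNN.hidden ρ y (N.tap j) p) k) + N.outBias j i

/-- The number of nonzero weights: filter entries and biases, those of the outputs included. -/
def weights (N : MultiOutputCNN s d e) : ℕ :=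
  N.toDCNN.hiddenWeights +
    ∑ j, ((∑ i, ∑ p, nnz (N.outFilter j i p)) + nnz (N.outBias j))

end MultiOutputCNN

end DeepSparseCoding

end

noncomputable section

namespace DeepSparseCoding

/-! The constants may depend on the dictionaries and on the sparsity levels, so it suffices to find
one decoder whose size is a number `Q` determined by these data alone. If `K < Q`, the zero network
works: its error is bounded in terms of `B`, and a factor `exp Q` in the constant absorbs it. If `Q
≤ K`, the decoder fits the budget, because `Q ≤ m * K`.

The decoder is piecewise linear. Below the coherence threshold a dictionary `D` satisfies `‖z‖ ≤ κ
‖D z‖` for every `z` of twice the admissible sparsity (`exists_norm_le_mul_norm_mulVec`). Each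
admissible support `S` therefore has a linear left inverse `P_S`, and the code is estimated
entrywise by the minimum over `S` of `(P_S y)_i + κ ‖y - D P_S y‖₁`. Stability shows that no
candidate lies far below `x_i`, while the true support gives a candidate that is not far above it
(`exists_sparse_decoder`). Composing these maps decodes all layers with an error linear in the noise
(`exists_deep_decoder`).

Such a map is a finite ReLU program. Since `ρ (η t) / η` differs from the ReLU by at most `β / η`,
rescaling the weights runs the program to any accuracy without enlarging it. A convolutional network
runs it by storing the registers in channels, raised by a large bias so that `ρ` acts on them as the
identity (`exists_network_approximation`). With accuracy `exp (-K)` the error is already below the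
first two terms of the claimed bound; the third only has to be nonnegative. -/

/-! ### Straight-line programs -/

/-- The registers of a straight-line program on the input `y`: the first ones hold `y`, and each
later one holds `σ` of an affine function of the registers before it. -/
def reg (σ : ℝ → ℝ) (a : ℕ → ℕ → ℝ) (b : ℕ → ℝ) {d : ℕ} (y : Fin d → ℝ) (q : ℕ) : ℝ :=
  if h : q < d then y ⟨q, h⟩ else σ ((∑ i : Fin q, a q i * reg σ a b y i) + b q)
decreasing_by exact i.2

lemma reg_of_lt (σ : ℝ → ℝ) (a : ℕ → ℕ → ℝ) (b : ℕ → ℝ) {d : ℕ} (y : Fin d → ℝ) {q : ℕ}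
    (h : q < d) : reg σ a b y q = y ⟨q, h⟩ := by
  rw [reg, dif_pos h]

lemma reg_of_le (σ : ℝ → ℝ) (a : ℕ → ℕ → ℝ) (b : ℕ → ℝ) {d : ℕ} (y : Fin d → ℝ) {q : ℕ}
    (h : d ≤ q) :
    reg σ a b y q = σ ((∑ i ∈ Finset.range q, a q i * reg σ a b y i) + b q) := by
  rw [reg, dif_neg (not_lt.2 h), Finset.sum_range (fun i => a q i * reg σ a b y i)]

lemma reg_congr (σ : ℝ → ℝ) {a a' : ℕ → ℕ → ℝ} {b b' : ℕ → ℝ} {d n : ℕ} (y : Fin d → ℝ)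
    (h : ∀ q < n, a q = a' q ∧ b q = b' q) :
    ∀ q < n, reg σ a b y q = reg σ a' b' y q := by
  intro q
  induction q using Nat.strong_induction_on with
  | _ q ih =>
    intro hq
    rcases lt_or_ge q d with hd | hd
    · rw [reg_of_lt _ _ _ _ hd, reg_of_lt _ _ _ _ hd]
    · rw [reg_of_le _ _ _ _ hd, reg_of_le _ _ _ _ hd, (h q hq).1, (h q hq).2]
      congr 2
      refine Finset.sum_congr rfl fun i hi => ?_
      rw [ih i (Finset.mem_range.1 hi) ((Finset.mem_range.1 hi).trans hq)]

/-- The rectified linear unit. -/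
def relu (t : ℝ) : ℝ := max t 0

/-- `f` is an affine function of the first `n` registers of a ReLU program. -/
def AffineInRegs {d : ℕ} (a : ℕ → ℕ → ℝ) (b : ℕ → ℝ) (n : ℕ) (f : (Fin d → ℝ) → ℝ) : Prop :=
  ∃ (α : ℕ → ℝ) (γ : ℝ), ∀ y, f y = (∑ i ∈ Finset.range n, α i * reg relu a b y i) + γ

lemma AffineInRegs.extend {d n n' : ℕ} {a a' : ℕ → ℕ → ℝ} {b b' : ℕ → ℝ}
    {f : (Fin d → ℝ) → ℝ} (hf : AffineInRegs a b n f) (hn : n ≤ n')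
    (h : ∀ q < n, a q = a' q ∧ b q = b' q) : AffineInRegs a' b' n' f := by
  obtain ⟨α, γ, hf⟩ := hf
  refine ⟨fun i => if i < n then α i else 0, γ, fun y => ?_⟩
  rw [hf, ← Finset.sum_subset (Finset.range_mono hn)]
  · congr 1
    refine Finset.sum_congr rfl fun i hi => ?_
    simp only [if_pos (Finset.mem_range.1 hi)]
    rw [reg_congr relu y h i (Finset.mem_range.1 hi)]
  · intro i _ hi
    have hi' : ¬ i < n := by simpa using hi
    simp only [if_neg hi', zero_mul]

/-! ### Closure properties of the functions computed by ReLU programs -/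

/-- Every ReLU program can be extended to one that computes `f`. -/
def ReLUComputable {d : ℕ} (f : (Fin d → ℝ) → ℝ) : Prop :=
  ∀ (a : ℕ → ℕ → ℝ) (b : ℕ → ℝ) (n : ℕ), d ≤ n →
    ∃ (a' : ℕ → ℕ → ℝ) (b' : ℕ → ℝ) (n' : ℕ), n ≤ n' ∧ (∀ q < n, a q = a' q ∧ b q = b' q) ∧
      AffineInRegs a' b' n' f

namespace ReLUComputable

variable {d : ℕ} {f g : (Fin d → ℝ) → ℝ}

lemma coord (i : Fin d) : ReLUComputable fun y : Fin d → ℝ => y i := by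
  refine fun a b n hn => ⟨a, b, n, le_rfl, fun _ _ => ⟨rfl, rfl⟩, fun q => if q = i then 1 else 0,
    0, fun y => ?_⟩
  simp [lt_of_lt_of_le i.2 hn, reg_of_lt _ _ _ y i.2]

lemma const (r : ℝ) : ReLUComputable fun _ : Fin d → ℝ => r :=
  fun a b n _ => ⟨a, b, n, le_rfl, fun _ _ => ⟨rfl, rfl⟩, 0, r, fun y => by simp⟩

/-- The program for the second function is built on top of the one for the first. Defining
computability by extension of arbitrary programs is what makes this composition possible. -/
lemma add (hf : ReLUComputable f) (hg : ReLUComputable g) :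
    ReLUComputable fun y => f y + g y := by
  intro a b n hn
  obtain ⟨a₁, b₁, n₁, hn₁, h₁, hf⟩ := hf a b n hn
  obtain ⟨a₂, b₂, n₂, hn₂, h₂, α', γ', hg⟩ := hg a₁ b₁ n₁ (hn.trans hn₁)
  obtain ⟨α, γ, hf⟩ := hf.extend hn₂ h₂
  refine ⟨a₂, b₂, n₂, hn₁.trans hn₂, fun q hq => ⟨(h₁ q hq).1.trans (h₂ q (hq.trans_le hn₁)).1,
    (h₁ q hq).2.trans (h₂ q (hq.trans_le hn₁)).2⟩, fun i => α i + α' i, γ + γ', fun y => ?_⟩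
  simp only [hf, hg, add_mul, Finset.sum_add_distrib]
  ring

lemma const_mul (r : ℝ) (hf : ReLUComputable f) : ReLUComputable fun y => r * f y := by
  intro a b n hn
  obtain ⟨a₁, b₁, n₁, hn₁, h₁, α, γ, hf⟩ := hf a b n hn
  refine ⟨a₁, b₁, n₁, hn₁, h₁, fun i => r * α i, r * γ, fun y => ?_⟩
  simp only [hf, mul_add, Finset.mul_sum, mul_assoc]

lemma relu (hf : ReLUComputable f) : ReLUComputable fun y => relu (f y) := by
  intro a b n hn
  obtain ⟨a₁, b₁, n₁, hn₁, h₁, α, γ, hf⟩ := hf a b n hn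
  have hupd : ∀ q < n₁, a₁ q = Function.update a₁ n₁ α q ∧ b₁ q = Function.update b₁ n₁ γ q :=
    fun q hq => by simp [hq.ne]
  refine ⟨Function.update a₁ n₁ α, Function.update b₁ n₁ γ, n₁ + 1, hn₁.trans (Nat.le_succ _),
    fun q hq => ⟨(h₁ q hq).1.trans (hupd q (hq.trans_le hn₁)).1,
      (h₁ q hq).2.trans (hupd q (hq.trans_le hn₁)).2⟩,
    fun i => if i = n₁ then 1 else 0, 0, fun y => ?_⟩
  simp only [ite_mul, one_mul, zero_mul, Finset.sum_ite_eq', Finset.mem_range, Nat.lt_succ_self,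
    if_true, add_zero]
  rw [reg_of_le _ _ _ _ (hn.trans hn₁), hf, Function.update_self, Function.update_self]
  congr 2
  refine Finset.sum_congr rfl fun i hi => ?_
  rw [reg_congr _ y hupd i (Finset.mem_range.1 hi)]

lemma sub (hf : ReLUComputable f) (hg : ReLUComputable g) :
    ReLUComputable fun y => f y - g y := by
  simpa [sub_eq_add_neg] using hf.add (hg.const_mul (-1))

lemma abs (hf : ReLUComputable f) : ReLUComputable fun y => |f y| := by
  have h := hf.relu.add (hf.const_mul (-1)).relu
  convert h using 2 with y
  rcases le_total 0 (f y) with h0 | h0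
  · simp [DeepSparseCoding.relu, abs_of_nonneg h0, h0]
  · simp [DeepSparseCoding.relu, abs_of_nonpos h0, h0]

/-- Uses `min f g = f - relu (f - g)`. -/
lemma inf (hf : ReLUComputable f) (hg : ReLUComputable g) :
    ReLUComputable fun y => f y ⊓ g y := by
  have h := hf.sub (hf.sub hg).relu
  convert h using 2 with y
  rcases le_total (f y) (g y) with h0 | h0
  · simp [DeepSparseCoding.relu, h0]
  · simp [DeepSparseCoding.relu, h0]

lemma sum {ι : Type*} (s : Finset ι) {F : ι → (Fin d → ℝ) → ℝ}
    (hF : ∀ i, ReLUComputable (F i)) : ReLUComputable fun y => ∑ i ∈ s, F i y := by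
  classical
  induction s using Finset.induction_on with
  | empty => simpa using const (d := d) 0
  | insert i s hi ih => simpa [Finset.sum_insert hi] using (hF i).add ih

lemma inf' {ι : Type*} (s : Finset ι) (hs : s.Nonempty) {F : ι → (Fin d → ℝ) → ℝ}
    (hF : ∀ i, ReLUComputable (F i)) : ReLUComputable fun y => s.inf' hs fun i => F i y := by
  classical
  induction hs using Finset.Nonempty.cons_induction with
  | singleton i => simpa using hF i
  | cons i s hi hs ih =>
    simp only [Finset.inf'_cons hs]
    exact (hF i).inf ih

lemma linearMap {p n : ℕ} (T : (Fin p → ℝ) →ₗ[ℝ] (Fin n → ℝ)) (i : Fin n)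
    {G : (Fin d → ℝ) → Fin p → ℝ} (hG : ∀ k, ReLUComputable fun y => G y k) :
    ReLUComputable fun y => T (G y) i := by
  have h : ∀ y, T (G y) i = ∑ k, T (Pi.single k 1) i * G y k := by
    intro y
    conv_lhs => rw [LinearMap.pi_apply_eq_sum_univ T (G y)]
    simp only [Finset.sum_apply, Pi.smul_apply, smul_eq_mul]
    refine Finset.sum_congr rfl fun k _ => ?_
    have e : (fun l => if k = l then (1 : ℝ) else 0) = Pi.single k 1 := by
      ext l
      simp [Pi.single_apply, eq_comm]
    rw [mul_comm, e]
  simp only [h]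
  exact sum _ fun k => (hG k).const_mul _

/-- Finitely many computable functions are computed by one program. -/
lemma exists_program {ι : Type*} (s : Finset ι) {F : ι → (Fin d → ℝ) → ℝ}
    (hF : ∀ i, ReLUComputable (F i)) :
    ∃ (a : ℕ → ℕ → ℝ) (b : ℕ → ℝ) (n : ℕ), d ≤ n ∧ ∀ i ∈ s, AffineInRegs a b n (F i) := by
  classical
  induction s using Finset.induction_on with
  | empty => exact ⟨0, 0, d, le_rfl, by simp⟩
  | insert i s hi ih =>
    obtain ⟨a, b, n, hn, h⟩ := ih
    obtain ⟨a', b', n', hn', h', hi'⟩ := hF i a b n hn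
    refine ⟨a', b', n', hn.trans hn', fun k hk => ?_⟩
    rcases Finset.mem_insert.1 hk with rfl | hk
    · exact hi'
    · exact (h k hk).extend hn' h'

end ReLUComputable

/-! ### Programs with a generalized ReLU -/

section activation

variable {ρ : ℝ → ℝ} {β L : ℝ}

lemma IsGeneralizedReLU.bound_nonneg (h : IsGeneralizedReLU ρ β L) : 0 ≤ β :=
  (abs_nonneg _).trans (h.bound (-1) (by norm_num))

lemma IsGeneralizedReLU.lipschitz_nonneg (h : IsGeneralizedReLU ρ β L) : 0 ≤ L := by
  simpa using (abs_nonneg _).trans (h.lipschitz (-1) 0 (by norm_num) le_rfl)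

lemma IsGeneralizedReLU.abs_le (h : IsGeneralizedReLU ρ β L) (t : ℝ) : |ρ t| ≤ |t| + β := by
  rcases le_or_gt 0 t with ht | ht
  · rw [h.eq_self t ht]
    linarith [h.bound_nonneg]
  · linarith [h.bound t ht, abs_nonneg t]

/-- On the positive half-line `ρ` is homogeneous and there is no error. On the negative one the ReLU
vanishes and `ρ` is bounded by `β`, which the division by `η` makes small. -/
lemma IsGeneralizedReLU.abs_scaled_sub_relu_le (h : IsGeneralizedReLU ρ β L) {η : ℝ} (hη : 0 < η)
    (t : ℝ) : |ρ (η * t) / η - relu t| ≤ β / η := by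
  rcases le_or_gt 0 t with ht | ht
  · rw [h.eq_self _ (by positivity), relu, max_eq_left ht, mul_div_cancel_left₀ _ hη.ne', sub_self,
      abs_zero]
    exact div_nonneg h.bound_nonneg hη.le
  · rw [relu, max_eq_right ht.le, sub_zero, abs_div, abs_of_pos hη]
    gcongr
    exact h.bound _ (mul_neg_of_pos_of_neg hη ht)

lemma abs_relu_sub_relu_le (t u : ℝ) : |relu t - relu u| ≤ |t - u| :=
  abs_max_sub_max_le_abs t u 0

/-- A bound for the registers on a bounded set of inputs. -/
lemma IsGeneralizedReLU.abs_reg_le (h : IsGeneralizedReLU ρ β L) (a : ℕ → ℕ → ℝ) (b : ℕ → ℝ)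
    {d : ℕ} {R : ℝ} {y : Fin d → ℝ} (hy : ∀ i, |y i| ≤ R) (q : ℕ) :
    |reg ρ a b y q| ≤
      reg (fun t => t) (fun q i => |a q i|) (fun q => |b q| + β) (fun _ : Fin d => R) q := by
  induction q using Nat.strong_induction_on with
  | _ q ih =>
    rcases lt_or_ge q d with hd | hd
    · rw [reg_of_lt _ _ _ _ hd, reg_of_lt _ _ _ _ hd]
      exact hy _
    · rw [reg_of_le _ _ _ _ hd, reg_of_le _ _ _ _ hd]
      refine (h.abs_le _).trans ?_
      rw [← add_assoc]
      gcongr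
      refine (abs_add_le _ _).trans ?_
      gcongr
      refine (Finset.abs_sum_le_sum_abs _ _).trans (Finset.sum_le_sum fun i hi => ?_)
      rw [abs_mul]
      gcongr
      exact ih i (Finset.mem_range.1 hi)

/-- The factor by which register `q` is scaled when the activations are scaled by `η`. -/
def regScale (d : ℕ) (η : ℝ) (q : ℕ) : ℝ := if q < d then 1 else η

/-- Scaling the activations by `η` reduces their deviation from the ReLU to `β / η`. -/
lemma IsGeneralizedReLU.abs_scaled_reg_sub_le (h : IsGeneralizedReLU ρ β L) (a : ℕ → ℕ → ℝ)
    (b : ℕ → ℝ) {d : ℕ} (y : Fin d → ℝ) {η : ℝ} (hη : 0 < η) (q : ℕ) :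
    |reg ρ (fun q i => η * (a q i / regScale d η i)) (fun q => η * b q) y q / regScale d η q
        - reg relu a b y q| ≤
      reg (fun t => t) (fun q i => |a q i|) (fun _ => 1) (fun _ : Fin d => 0) q * (β / η) := by
  induction q using Nat.strong_induction_on with
  | _ q ih =>
    rcases lt_or_ge q d with hd | hd
    · simp [reg_of_lt _ _ _ _ hd, regScale, hd]
    · rw [reg_of_le _ _ _ _ hd, reg_of_le _ _ _ _ hd, reg_of_le _ _ _ _ hd]
      rw [show regScale d η q = η by simp [regScale, hd]]
      set z := reg ρ (fun q i => η * (a q i / regScale d η i)) (fun q => η * b q) y with hz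
      -- In the variables `z i / regScale d η i` the program has its original coefficients, and its
      -- activation is `t ↦ ρ (η t) / η`. Each register thus adds a fresh error `β / η` to the
      -- errors propagated through `|a q i|`; this recursion is the linear program with bias 1 and
      -- zero input in the bound.
      have e : (∑ i ∈ Finset.range q, η * (a q i / regScale d η i) * z i) + η * b q
          = η * ((∑ i ∈ Finset.range q, a q i * (z i / regScale d η i)) + b q) := by
        rw [mul_add, Finset.mul_sum]
        congr 1
        exact Finset.sum_congr rfl fun i _ => by ring
      rw [e, add_mul, one_mul, Finset.sum_mul]
      refine (abs_sub_le _ _ _).trans ((add_le_add (h.abs_scaled_sub_relu_le hη _)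
        (abs_relu_sub_relu_le _ _)).trans ?_)
      rw [add_comm]
      gcongr
      rw [add_sub_add_right_eq_sub, ← Finset.sum_sub_distrib]
      refine (Finset.abs_sum_le_sum_abs _ _).trans (Finset.sum_le_sum fun i hi => ?_)
      rw [← mul_sub, abs_mul, mul_assoc]
      gcongr
      exact ih i (Finset.mem_range.1 hi)

end activation

/-! ### Convolutional networks that run programs -/

lemma sum_single_tap {s : ℕ} {c : ℕ} (hc : c < s) (r : ℝ) (f : ℕ → ℝ) :
    ∑ k : Fin s, (if (k : ℕ) = c then r else 0) * f k = r * f c := by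
  rw [Finset.sum_eq_single ⟨c, hc⟩]
  · simp
  · intro k _ hk
    rw [if_neg (fun h => hk (Fin.ext h)), zero_mul]
  · simp

lemma nnz_single_tap_le {s : ℕ} (c : ℕ) (r : ℝ) :
    nnz (fun k : Fin s => if (k : ℕ) = c then r else 0) ≤ 1 := by
  rw [nnz, Set.ncard_le_one_iff]
  intro i j hi hj
  simp only [ne_eq, ite_eq_right_iff, Classical.not_imp, Set.mem_ofPred_eq] at hi hj
  exact Fin.ext (hi.1.trans hj.1.symm)

lemma nnz_le_card {ι : Type} [Fintype ι] (v : ι → ℝ) : nnz v ≤ Fintype.card ι := by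
  rw [nnz, ← Nat.card_eq_fintype_card]
  exact Set.ncard_le_card _

namespace DCNN

variable {s d : ℕ}

lemma size_of_stride_one (N : DCNN s d) (h : ∀ l, N.stride l = 1) (l : ℕ) : N.size l = d := by
  induction l with
  | zero => rfl
  | succ l ih => rw [size, ih, h, ceilDiv_one]

lemma pad_hidden_succ (N : DCNN s d) (h : ∀ l, N.stride l = 1) (ρ : ℝ → ℝ) (y : Fin d → ℝ) (l : ℕ)
    (q : Fin (N.channels (l + 1))) {i : ℕ} (hi : i < d) :
    pad (N.hidden ρ y (l + 1) q) i =
      ρ ((∑ p, ∑ k : Fin s, N.filter l q p k * pad (N.hidden ρ y l p) (i + k)) + N.bias l q) := by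
  rw [pad, dif_pos (by rwa [N.size_of_stride_one h]), hidden]
  simp only [conv, h, mul_one]

end DCNN

/-- The offset which channel `q` carries in layer `l`. -/
def offset (d : ℕ) (M : ℝ) (l q : ℕ) : ℝ := if q < d then l * M else ((l : ℝ) - q) * M

/-- The nonzero entry of the filter from channel `p` to channel `q` of layer `l + 1`. -/
def programCoeff (d : ℕ) (a : ℕ → ℕ → ℝ) (l q p : ℕ) : ℝ :=
  if q ≤ l then (if p = q then 1 else 0)
  else if l + 1 < d then (if p = l then 1 else 0)
  else a (l + 1) p

/-- The position of the nonzero entry of the filters to channel `q` of layer `l + 1`. -/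
def programTap (d l q : ℕ) : ℕ := if q ≤ l then 0 else if l + 1 < d then 1 else 0

/-- The bias of channel `q` of layer `l + 1`. -/
def programBias (d : ℕ) (a : ℕ → ℕ → ℝ) (b : ℕ → ℝ) (M : ℝ) (l q : ℕ) : ℝ :=
  if q ≤ l then M else if l + 1 < d then M
  else b (l + 1) - ∑ i ∈ Finset.range (l + 1), a (l + 1) i * offset d M l i

/-- The network that runs the program `(a, b)`.  Layer `l + 1` keeps the channels of layer `l`,
raised by `M`, and adds one channel: the shift of the last one, while `l + 1 < d`, and the register
`l + 1` from then on. -/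
def programNet (s d : ℕ) (n : ℕ) (a : ℕ → ℕ → ℝ) (b : ℕ → ℝ) (M : ℝ) : DCNN s d where
  depth := n
  stride _ := 1
  channels l := l + 1
  filter l q p k := if (k : ℕ) = programTap d l q then programCoeff d a l q p else 0
  bias l q := programBias d a b M l q
  stride_pos _ := le_rfl
  channels_pos _ := Nat.succ_pos _
  channels_zero := rfl

/-- Entry `i` of channel `q` of layer `l` of the network that runs the program `(a, b)`. -/
def programValue (s d : ℕ) (n : ℕ) (a : ℕ → ℕ → ℝ) (b : ℕ → ℝ) (M : ℝ) (ρ : ℝ → ℝ)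
    (y : Fin d → ℝ) (l : ℕ) (q : Fin (l + 1)) (i : ℕ) : ℝ :=
  pad ((programNet s d n a b M).hidden ρ y l q) i

lemma programValue_zero (s : ℕ) {d : ℕ} (n : ℕ) (a : ℕ → ℕ → ℝ) (b : ℕ → ℝ) (M : ℝ)
    (ρ : ℝ → ℝ) (y : Fin d → ℝ) (q : Fin (0 + 1)) {i : ℕ} (hi : i < d) :
    programValue s d n a b M ρ y 0 q i = y ⟨i, hi⟩ :=
  dif_pos hi

lemma programValue_succ {s d : ℕ} (hs : 2 ≤ s) (n : ℕ) (a : ℕ → ℕ → ℝ) (b : ℕ → ℝ) (M : ℝ)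
    (ρ : ℝ → ℝ) (y : Fin d → ℝ) (l : ℕ) (q : Fin (l + 1 + 1)) {i : ℕ} (hi : i < d) :
    programValue s d n a b M ρ y (l + 1) q i =
      ρ ((∑ p : Fin (l + 1), programCoeff d a l q p *
        programValue s d n a b M ρ y l p (i + programTap d l q)) + programBias d a b M l q) := by
  refine (DCNN.pad_hidden_succ (programNet s d n a b M) (fun _ => rfl) ρ y l q hi).trans ?_
  refine congrArg (fun t => ρ (t + programBias d a b M l q)) (Finset.sum_congr rfl fun p _ => ?_)
  refine sum_single_tap (s := s) ?_ _
    (fun k => programValue s d n a b M ρ y l p (i + k))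
  unfold programTap
  split_ifs <;> omega

/-- In layer `l`, channel `q` holds the input entries from `q` on, if `q < d`, and register `q`
otherwise. -/
lemma programValue_eq {s d : ℕ} (hs : 2 ≤ s) (hd : 1 ≤ d) {n : ℕ} (hdn : d ≤ n + 1)
    (a : ℕ → ℕ → ℝ) (b : ℕ → ℝ) {M : ℝ} {ρ : ℝ → ℝ} (hρ : ∀ t, 0 ≤ t → ρ t = t)
    {y : Fin d → ℝ} (hM : ∀ q ≤ n, |reg ρ a b y q| ≤ M) :
    ∀ l ≤ n, ∀ q : Fin (l + 1), ∀ i, (i = 0 ∨ (q : ℕ) + i < d) →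
      programValue s d n a b M ρ y l q i =
        reg ρ a b y (q + i) + offset d M l q := by
  have hM0 : 0 ≤ M := (abs_nonneg _).trans (hM 0 (Nat.zero_le _))
  -- For `q ≥ d` only entry 0 of the channel is controlled, and later registers read only that
  -- entry.
  intro l
  induction l with
  | zero =>
    intro _ q i hi
    have hq : (q : ℕ) = 0 := by omega
    have hi' : i < d := by omega
    rw [programValue_zero _ _ _ _ _ _ _ _ hi', hq, zero_add, offset, if_pos (by omega),
      reg_of_lt _ _ _ _ hi', Nat.cast_zero, zero_mul, add_zero]
  | succ l ih =>
    intro hl q i hi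
    have hi' : i < d := by omega
    rw [programValue_succ hs n a b M ρ y l q hi']
    by_cases hq : (q : ℕ) ≤ l
    · simp only [programCoeff, programTap, if_pos hq, ite_mul, one_mul, zero_mul, add_zero]
      rw [Finset.sum_eq_single (⟨q, by omega⟩ : Fin (l + 1)) (fun p _ hp => if_neg fun h =>
        hp (Fin.ext h)) (by simp), if_pos rfl, ih (by omega) ⟨q, by omega⟩ i hi]
      have hb : programBias d a b M l q = M := if_pos hq
      have hoff : offset d M l q + M = offset d M (l + 1) q := by
        unfold offset
        split_ifs <;> push_cast <;> ring
      have hoff0 : 0 ≤ offset d M l q := by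
        unfold offset
        have : ((q : ℕ) : ℝ) ≤ l := by exact_mod_cast hq
        split_ifs
        · positivity
        · exact mul_nonneg (by linarith) hM0
      -- The raised value is nonnegative because the register is at least `-M`, so `ρ` fixes it.
      rw [hb, add_assoc, hoff]
      refine hρ _ ?_
      have := neg_le_of_abs_le (hM (q + i) (by omega))
      linarith
    · have hql : (q : ℕ) = l + 1 := by omega
      by_cases hld : l + 1 < d
      -- Tap 1 moves the signal by one entry, bringing input `l + 1` to position 0. This is where a
      -- filter size of at least 2 is needed.
      · simp only [programCoeff, programTap, if_neg hq, if_pos hld, ite_mul, one_mul, zero_mul]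
        rw [Finset.sum_eq_single (⟨l, by omega⟩ : Fin (l + 1)) (fun p _ hp => if_neg fun h =>
          hp (Fin.ext h)) (by simp), if_pos rfl, ih (by omega) ⟨l, by omega⟩ (i + 1)
          (Or.inr (by simp only; omega))]
        have hb : programBias d a b M l q = M := by
          refine (if_neg hq).trans (if_pos hld)
        have e : l + (i + 1) = q + i := by omega
        rw [hb]
        simp only [e, offset]
        rw [if_pos (by omega), if_pos (by omega), add_assoc,
          show (l : ℝ) * M + M = ((l + 1 : ℕ) : ℝ) * M by push_cast; ring]
        refine hρ _ ?_
        have := neg_le_of_abs_le (hM (q + i) (by omega))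
        have : 0 ≤ (l : ℝ) * M := by positivity
        push_cast
        linarith
      -- A new register is not raised: its bias cancels the offsets of the channels it reads, so `ρ`
      -- receives exactly the argument prescribed by the program.
      · obtain rfl : i = 0 := by omega
        simp only [programCoeff, programTap, if_neg hq, if_neg hld, add_zero]
        have hb : programBias d a b M l q =
            b (l + 1) - ∑ i ∈ Finset.range (l + 1), a (l + 1) i * offset d M l i :=
          (if_neg hq).trans (if_neg hld)
        have hoff : offset d M (l + 1) q = 0 := by
          rw [offset, if_neg (by omega), hql, sub_self, zero_mul]
        rw [hb, hoff, add_zero, hql, reg_of_le _ _ _ _ (by omega), Finset.sum_range,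
          Finset.sum_range]
        congr 1
        rw [add_sub_left_comm, add_comm, ← Finset.sum_sub_distrib]
        congr 1
        refine Finset.sum_congr rfl fun p _ => ?_
        rw [ih (by omega) p 0 (Or.inl rfl), add_zero]
        ring

/-- Every filter has at most one nonzero tap, so the count is independent of `s`. -/
lemma programNet_hiddenWeights_le (s d n : ℕ) (a : ℕ → ℕ → ℝ) (b : ℕ → ℝ) (M : ℝ) :
    (programNet s d n a b M).hiddenWeights ≤
      ∑ l ∈ Finset.range n, ((l + 2) * (l + 1) + (l + 2)) := by
  refine Finset.sum_le_sum fun l _ => Nat.add_le_add ?_ ?_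
  · refine (Finset.sum_le_sum fun q _ => Finset.sum_le_sum fun p _ =>
      nnz_single_tap_le (s := s) _ _).trans ?_
    refine le_of_eq (?_ : ∑ _q : Fin (l + 2), ∑ _p : Fin (l + 1), 1 = _)
    simp
  · exact (nnz_le_card _).trans (Fintype.card_fin (l + 2)).le

/-- The network that runs the program `(a, b)` and returns affine functions of the registers. -/
def programOutputNet (s d : ℕ) {J : ℕ} (e : Fin J → ℕ) (n : ℕ) (a : ℕ → ℕ → ℝ) (b : ℕ → ℝ) (M : ℝ)
    (α : (j : Fin J) → Fin (e j) → ℕ → ℝ) (γ : (j : Fin J) → Fin (e j) → ℝ) :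
    MultiOutputCNN s d e where
  toDCNN := programNet s d n a b M
  tap _ := n
  tap_le _ := le_rfl
  outFilter j i p k := if (k : ℕ) = 0 then α j i p else 0
  outBias j i := γ j i - ∑ p ∈ Finset.range (n + 1), α j i p * offset d M n p

lemma programOutputNet_output {s d : ℕ} (hs : 2 ≤ s) (hd : 1 ≤ d) {J : ℕ} (e : Fin J → ℕ) {n : ℕ}
    (hdn : d ≤ n + 1) (a : ℕ → ℕ → ℝ) (b : ℕ → ℝ) {M : ℝ}
    (α : (j : Fin J) → Fin (e j) → ℕ → ℝ) (γ : (j : Fin J) → Fin (e j) → ℝ)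
    {ρ : ℝ → ℝ} (hρ : ∀ t, 0 ≤ t → ρ t = t)
    {y : Fin d → ℝ} (hM : ∀ q ≤ n, |reg ρ a b y q| ≤ M) (j : Fin J) (i : Fin (e j)) :
    (programOutputNet s d e n a b M α γ).output ρ y j i =
      (∑ p ∈ Finset.range (n + 1), α j i p * reg ρ a b y p) + γ j i := by
  have h : ∀ p : Fin (n + 1), ∑ k : Fin s, (if (k : ℕ) = 0 then α j i p else 0) *
      programValue s d n a b M ρ y n p k
      = α j i p * (reg ρ a b y p + offset d M n p) := by
    intro p
    rw [sum_single_tap (s := s) (by omega) _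
      (fun k => programValue s d n a b M ρ y n p k),
      programValue_eq hs hd hdn a b hρ hM n le_rfl p 0 (Or.inl rfl), add_zero]
  refine (congrArg (· + (γ j i - ∑ p ∈ Finset.range (n + 1), α j i p * offset d M n p))
    (Finset.sum_congr rfl fun p _ => h p : _ = ∑ p : Fin (n + 1), _)).trans ?_
  simp only [mul_add]
  rw [Finset.sum_add_distrib, Finset.sum_range, Finset.sum_range]
  ring

lemma programOutputNet_weights_le (s d : ℕ) {J : ℕ} (e : Fin J → ℕ) (n : ℕ) (a : ℕ → ℕ → ℝ)
    (b : ℕ → ℝ) (M : ℝ) (α : (j : Fin J) → Fin (e j) → ℕ → ℝ) (γ : (j : Fin J) → Fin (e j) → ℝ) :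
    (programOutputNet s d e n a b M α γ).weights ≤
      (∑ l ∈ Finset.range n, ((l + 2) * (l + 1) + (l + 2))) + ∑ j, (e j * (n + 1) + e j) := by
  refine Nat.add_le_add (programNet_hiddenWeights_le s d n a b M)
    (Finset.sum_le_sum fun j _ => Nat.add_le_add ?_ ?_)
  · refine (Finset.sum_le_sum fun q _ => Finset.sum_le_sum fun p _ =>
      nnz_single_tap_le (s := s) _ _).trans ?_
    refine le_of_eq (?_ : ∑ _q : Fin (e j), ∑ _p : Fin (n + 1), 1 = _)
    simp
  · exact (nnz_le_card _).trans (by simp)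

/-! ### Uniform approximation by networks of fixed size -/

/-- Functions that are computable with the ReLU are approximated, on bounded sets and with any
accuracy, by networks whose size depends neither on the activation function nor on the filter size
nor on the accuracy. -/
theorem exists_network_approximation {d : ℕ} (hd : 1 ≤ d) {J : ℕ} {e : Fin J → ℕ}
    {F : (j : Fin J) → Fin (e j) → (Fin d → ℝ) → ℝ} (hF : ∀ j i, ReLUComputable (F j i)) :
    ∃ Q : ℕ, ∀ (ρ : ℝ → ℝ) (β L : ℝ), IsGeneralizedReLU ρ β L → ∀ s : ℕ, 2 ≤ s →
      ∀ (R ε : ℝ), 0 < ε → ∃ N : MultiOutputCNN s d e, N.depth ≤ Q ∧ N.weights ≤ Q ∧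
        ∀ y : Fin d → ℝ, (∀ i, |y i| ≤ R) → ∀ j i, |N.output ρ y j i - F j i y| ≤ ε := by
  obtain ⟨a, b, n', hn', h⟩ := ReLUComputable.exists_program
    (Finset.univ : Finset ((j : Fin J) × Fin (e j))) (F := fun i => F i.1 i.2) fun i => hF i.1 i.2
  obtain ⟨n, rfl⟩ : ∃ n, n' = n + 1 := ⟨n' - 1, by omega⟩
  choose α γ hα using fun (j : Fin J) (i : Fin (e j)) => h ⟨j, i⟩ (Finset.mem_univ _)
  set W := (∑ l ∈ Finset.range n, ((l + 2) * (l + 1) + (l + 2))) + ∑ j, (e j * (n + 1) + e j)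
    with hW
  -- The size is fixed by the ReLU program before `ρ`, `s`, `R` and `ε` are known; these affect only
  -- the values of the weights.
  refine ⟨n + W, fun ρ β L hρ s hs R ε hε => ?_⟩
  set E := reg (fun t => t) (fun q i => |a q i|) (fun _ => 1) (fun _ : Fin d => 0) with hE
  set t : (j : Fin J) → Fin (e j) → ℝ := fun j i => ∑ q ∈ Finset.range (n + 1), |α j i q| * |E q|
    with ht
  have ht0 : ∀ j i, 0 ≤ t j i := fun j i => Finset.sum_nonneg fun q _ => by positivity
  set T := ∑ j, ∑ i, t j i with hT
  have hT0 : 0 ≤ T := Finset.sum_nonneg fun j _ => Finset.sum_nonneg fun i _ => ht0 j i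
  have htT : ∀ j i, t j i ≤ T := fun j i =>
    (Finset.single_le_sum (fun i _ => ht0 j i) (Finset.mem_univ i)).trans
      (Finset.single_le_sum (f := fun j => ∑ i, t j i)
        (fun j _ => Finset.sum_nonneg fun i _ => ht0 j i) (Finset.mem_univ j))
  have hβ := hρ.bound_nonneg
  -- Chosen so that `T * (β / η) ≤ ε`; the summand 1 keeps `η` positive when `T * β = 0`.
  set η := (T * β + 1) / ε with hη
  have hη0 : 0 < η := by positivity
  set a' : ℕ → ℕ → ℝ := fun q i => η * (a q i / regScale d η i) with ha'
  set b' : ℕ → ℝ := fun q => η * b q with hb'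
  set m := reg (fun t => t) (fun q i => |a' q i|) (fun q => |b' q| + β) (fun _ : Fin d => R)
    with hm
  set M := ∑ q ∈ Finset.range (n + 1), |m q| with hM
  refine ⟨programOutputNet s d e n a' b' M (fun j i q => α j i q / regScale d η q) γ,
    Nat.le_add_right _ _, (programOutputNet_weights_le _ _ _ _ _ _ _ _ _).trans
    (Nat.le_add_left _ _), fun y hy j i => ?_⟩
  have hMy : ∀ q ≤ n, |reg ρ a' b' y q| ≤ M := fun q hq =>
    ((hρ.abs_reg_le a' b' hy q).trans (le_abs_self _)).trans
      (Finset.single_le_sum (f := fun q => |m q|) (fun _ _ => abs_nonneg _)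
        (Finset.mem_range.2 (Nat.lt_succ_of_le hq)))
  rw [programOutputNet_output hs hd e hn' a' b' _ _ hρ.eq_self hMy, hα, add_sub_add_right_eq_sub,
    ← Finset.sum_sub_distrib]
  refine (Finset.abs_sum_le_sum_abs _ _).trans ?_
  calc _ ≤ ∑ q ∈ Finset.range (n + 1), |α j i q| * |E q| * (β / η) := by
        refine Finset.sum_le_sum fun q _ => ?_
        rw [div_mul_eq_mul_div, mul_div_assoc, ← mul_sub, abs_mul, mul_assoc]
        gcongr
        refine (hρ.abs_scaled_reg_sub_le a b y hη0 q).trans ?_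
        gcongr
        exact le_abs_self _
    _ = t j i * (β / η) := by rw [ht, Finset.sum_mul]
    _ ≤ T * (β / η) := by gcongr; exact htT j i
    _ ≤ ε := by
        rw [hη, ← mul_div_assoc, div_div_eq_mul_div, div_le_iff₀ (by positivity)]
        nlinarith

/-! ### Decoding one layer -/

lemma l2norm_sq {n : ℕ} (v : Fin n → ℝ) : l2norm v ^ 2 = ∑ i, v i ^ 2 := by
  simp [l2norm, EuclideanSpace.norm_sq_eq]

lemma l2norm_le_l1norm {n : ℕ} (v : Fin n → ℝ) : l2norm v ≤ l1norm v := by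
  have h0 : 0 ≤ l1norm v := Finset.sum_nonneg fun i _ => abs_nonneg _
  refine le_of_sq_le_sq ?_ h0
  rw [l2norm_sq, l1norm]
  calc ∑ i, v i ^ 2 = ∑ i, |v i| ^ 2 := by simp
    _ ≤ (∑ i, |v i|) ^ 2 := Finset.sum_sq_le_sq_sum_of_nonneg fun i _ => abs_nonneg _

lemma norm_le_l1norm {n : ℕ} (v : Fin n → ℝ) : ‖v‖ ≤ l1norm v := by
  refine (pi_norm_le_iff_of_nonneg (Finset.sum_nonneg fun i _ => abs_nonneg _)).2 fun i => ?_
  exact Finset.single_le_sum (f := fun i => |v i|) (fun i _ => abs_nonneg _) (Finset.mem_univ i)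

lemma l1norm_le_card_mul_norm {n : ℕ} (v : Fin n → ℝ) : l1norm v ≤ n * ‖v‖ := by
  refine (Finset.sum_le_card_nsmul _ _ ‖v‖ fun i _ => norm_le_pi_norm v i).trans ?_
  simp

lemma nnz_sub_le {n : ℕ} (v w : Fin n → ℝ) : nnz (v - w) ≤ nnz v + nnz w := by
  refine (Set.ncard_le_ncard (t := {i | v i ≠ 0} ∪ {i | w i ≠ 0}) fun i hi => ?_).trans
    (Set.ncard_union_le _ _)
  by_contra h
  simp only [Set.mem_union, Set.mem_ofPred_eq, not_or, not_not] at h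
  exact hi (by simp [h.1, h.2])

lemma nnz_le_of_support {n : ℕ} {v : Fin n → ℝ} {S : Finset (Fin n)} (h : ∀ i ∉ S, v i = 0) :
    nnz v ≤ S.card := by
  rw [nnz, ← Set.ncard_coe_finset]
  exact Set.ncard_le_ncard fun i hi => by
    by_contra hS
    exact hi (h i hS)

lemma sq_l1norm_le {n : ℕ} (v : Fin n → ℝ) : l1norm v ^ 2 ≤ nnz v * ∑ i, v i ^ 2 := by
  classical
  set S := Finset.univ.filter fun i => v i ≠ 0 with hS
  have hc : (nnz v : ℝ) = S.card := by
    rw [nnz, ← Set.ncard_coe_finset]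
    simp [hS]
  have h1 : l1norm v = ∑ i ∈ S, |v i| := by
    refine (Finset.sum_subset (Finset.subset_univ _) fun i _ hi => ?_).symm
    simpa [hS] using hi
  rw [h1, hc]
  refine sq_sum_le_card_mul_sum_sq.trans ?_
  gcongr
  simp only [sq_abs]
  exact Finset.sum_le_sum_of_subset_of_nonneg (Finset.subset_univ _) fun i _ _ => sq_nonneg _

/-! ### Coherence and stability on sparse vectors -/

lemma mutualCoherence_nonneg {p n : ℕ} (D : Matrix (Fin p) (Fin n) ℝ) : 0 ≤ mutualCoherence D :=
  Real.iSup_nonneg fun _ => div_nonneg (abs_nonneg _) (mul_nonneg (norm_nonneg _) (norm_nonneg _))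

lemma abs_dotProduct_le_mutualCoherence {p n : ℕ} {D : Matrix (Fin p) (Fin n) ℝ}
    (hD : ColumnNormalized D) {i j : Fin n} (hij : i ≠ j) :
    |Dᵀ i ⬝ᵥ Dᵀ j| ≤ mutualCoherence D := by
  have h := le_ciSup (f := fun q : {q : Fin n × Fin n // q.1 ≠ q.2} =>
    |Dᵀ q.1.1 ⬝ᵥ Dᵀ q.1.2| / (l2norm (Dᵀ q.1.1) * l2norm (Dᵀ q.1.2)))
    (Set.finite_range _).bddAbove ⟨(i, j), hij⟩
  simp only [hD i, hD j, mul_one, div_one] at h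
  exact h

/-- The dictionary is bounded from below on sparse vectors. -/
lemma le_l2norm_mulVec_sq {p n : ℕ} {D : Matrix (Fin p) (Fin n) ℝ} (hD : ColumnNormalized D)
    (z : Fin n → ℝ) :
    (1 + mutualCoherence D - nnz z * mutualCoherence D) * ∑ i, z i ^ 2 ≤ ∑ k, (D *ᵥ z) k ^ 2 := by
  set μ := mutualCoherence D with hμ
  have e : ∑ k, (D *ᵥ z) k ^ 2 = ∑ i, ∑ j, z i * z j * (Dᵀ i ⬝ᵥ Dᵀ j) := by
    simp only [Matrix.mulVec, dotProduct, sq, Finset.sum_mul_sum, Matrix.transpose_apply]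
    rw [Finset.sum_comm]
    refine Finset.sum_congr rfl fun i _ => ?_
    rw [Finset.sum_comm]
    refine Finset.sum_congr rfl fun j _ => ?_
    rw [Finset.mul_sum]
    exact Finset.sum_congr rfl fun k _ => by ring
  have hii : ∀ i, Dᵀ i ⬝ᵥ Dᵀ i = 1 := fun i => by
    have h := l2norm_sq (Dᵀ i)
    rw [hD i] at h
    simp only [dotProduct, ← sq]
    linarith
  -- The diagonal term is written as `(1 + μ) z_i² - μ |z_i|²`, so that the coherence terms add up
  -- to `μ ‖z‖₁²` over all pairs.
  have hterm : ∀ i j, (if i = j then (1 + μ) * z i ^ 2 else 0) - μ * (|z i| * |z j|) ≤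
      z i * z j * (Dᵀ i ⬝ᵥ Dᵀ j) := by
    intro i j
    split_ifs with hij
    · subst hij
      rw [hii, abs_mul_abs_self]
      nlinarith
    · have h1 : |z i * z j * (Dᵀ i ⬝ᵥ Dᵀ j)| ≤ μ * (|z i| * |z j|) := by
        rw [abs_mul, abs_mul, mul_comm]
        gcongr
        exact abs_dotProduct_le_mutualCoherence hD hij
      linarith [neg_le_of_abs_le h1]
  have hsum : ∑ i, ∑ j, ((if i = j then (1 + μ) * z i ^ 2 else 0) - μ * (|z i| * |z j|))
      = (1 + μ) * ∑ i, z i ^ 2 - μ * l1norm z ^ 2 := by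
    rw [l1norm, sq (∑ i, |z i|), Finset.sum_mul_sum]
    simp only [Finset.sum_sub_distrib, Finset.sum_ite_eq, Finset.mem_univ, if_true, Finset.mul_sum]
  rw [e]
  refine le_trans ?_ (Finset.sum_le_sum fun i _ => Finset.sum_le_sum fun j _ => hterm i j)
  rw [hsum]
  have := mul_le_mul_of_nonneg_left (sq_l1norm_le z) (mutualCoherence_nonneg D)
  rw [← hμ] at this
  linarith

/-- Twice the admissible sparsity is below the injectivity threshold of the dictionary. -/
lemma exists_norm_le_mul_norm_mulVec {p n : ℕ} {D : Matrix (Fin p) (Fin n) ℝ}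
    (hD : ColumnNormalized D) {lam : ℝ}
    (hlam : mutualCoherence D ≠ 0 → lam < 1 / 2 * (1 + 1 / mutualCoherence D)) :
    ∃ κ : ℝ, 0 ≤ κ ∧ ∀ z : Fin n → ℝ, (nnz z : ℝ) ≤ 2 * lam → ‖z‖ ≤ κ * ‖D *ᵥ z‖ := by
  set μ := mutualCoherence D with hμ
  have hμ0 : 0 ≤ μ := mutualCoherence_nonneg D
  -- This is the sparsity condition multiplied by `2μ`; for `μ = 0` the left side is 1, in
  -- accordance with `1/0 = +∞`.
  have hθ : 0 < 1 + μ - 2 * lam * μ := by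
    rcases hμ0.eq_or_lt with h | h
    · rw [← h]
      norm_num
    · have h1 := hlam h.ne'
      have h2 : 2 * lam * μ < 2 * (1 / 2 * (1 + 1 / μ)) * μ := by gcongr
      have h3 : 2 * (1 / 2 * (1 + 1 / μ)) * μ = 1 + μ := by field_simp; ring
      linarith
  set θ := 1 + μ - 2 * lam * μ with hθdef
  -- The inequality `1 / θ ≤ (1 / θ + 1)²` avoids a square root, and the factor `p` comes from
  -- comparing the Euclidean and sup norms.
  refine ⟨(1 / θ + 1) * (p + 1), by positivity, fun z hz => ?_⟩
  have h1 : θ * ‖z‖ ^ 2 ≤ (p * ‖D *ᵥ z‖) ^ 2 := by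
    calc θ * ‖z‖ ^ 2 ≤ θ * ∑ i, z i ^ 2 := by
          gcongr
          rw [← l2norm_sq]
          gcongr
          refine (pi_norm_le_iff_of_nonneg (norm_nonneg _)).2 fun i => ?_
          exact PiLp.norm_apply_le (WithLp.toLp 2 z) i
      _ ≤ (1 + μ - nnz z * μ) * ∑ i, z i ^ 2 := by
          have : (nnz z : ℝ) * μ ≤ 2 * lam * μ := by gcongr
          refine mul_le_mul_of_nonneg_right ?_ (Finset.sum_nonneg fun i _ => sq_nonneg _)
          linarith
      _ ≤ ∑ k, (D *ᵥ z) k ^ 2 := le_l2norm_mulVec_sq hD z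
      _ ≤ (p * ‖D *ᵥ z‖) ^ 2 := by
          rw [← l2norm_sq]
          have := (l2norm_le_l1norm (D *ᵥ z)).trans (l1norm_le_card_mul_norm _)
          gcongr
          exact norm_nonneg _
  refine le_of_sq_le_sq (b := (1 / θ + 1) * (p + 1) * ‖D *ᵥ z‖) ?_ (by positivity)
  calc ‖z‖ ^ 2 ≤ 1 / θ * (p * ‖D *ᵥ z‖) ^ 2 := by
        rw [one_div, ← div_eq_inv_mul, le_div_iff₀ hθ]
        linarith
    _ ≤ (1 / θ + 1) ^ 2 * ((p + 1) * ‖D *ᵥ z‖) ^ 2 := by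
        have : 0 ≤ 1 / θ := by positivity
        gcongr
        · nlinarith
        · linarith
    _ = _ := by ring

/-! ### Recovery of a sparse code by a minimum of piecewise linear candidates -/

/-- A linear decoder for the vectors supported in `S`. -/
lemma exists_decoder {p n : ℕ} (D : Matrix (Fin p) (Fin n) ℝ) (S : Finset (Fin n))
    (hinj : ∀ z : Fin n → ℝ, (∀ i ∉ S, z i = 0) → D *ᵥ z = 0 → z = 0) :
    ∃ P : (Fin p → ℝ) →ₗ[ℝ] (Fin n → ℝ), (∀ y, ∀ i ∉ S, P y i = 0) ∧
      ∀ z : Fin n → ℝ, (∀ i ∉ S, z i = 0) → P (D *ᵥ z) = z := by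
  let V : Submodule ℝ (Fin n → ℝ) :=
    { carrier := {z | ∀ i ∉ S, z i = 0}
      add_mem' := fun {x y} hx hy i hi => by simp [hx i hi, hy i hi]
      zero_mem' := fun _ _ => rfl
      smul_mem' := fun c x hx i hi => by simp [hx i hi] }
  have hker : LinearMap.ker ((Matrix.mulVecLin D).domRestrict V) = ⊥ := by
    refine LinearMap.ker_eq_bot'.2 fun z hz => ?_
    exact Subtype.ext (hinj z.1 z.2 hz)
  obtain ⟨g, hg⟩ := LinearMap.exists_leftInverse_of_injective _ hker
  refine ⟨V.subtype ∘ₗ g, fun y i hi => (g y).2 i hi, fun z hz => ?_⟩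
  exact congrArg Subtype.val (LinearMap.congr_fun hg ⟨z, hz⟩)

lemma exists_norm_linearMap_le {p n : ℕ} (T : (Fin p → ℝ) →ₗ[ℝ] (Fin n → ℝ)) :
    ∃ C : ℝ, 0 ≤ C ∧ ∀ v, ‖T v‖ ≤ C * ‖v‖ :=
  ⟨‖LinearMap.toContinuousLinearMap T‖, norm_nonneg _,
    (LinearMap.toContinuousLinearMap T).le_opNorm⟩

/-- Sparse codes are recovered from their noisy images by a piecewise linear map. -/
theorem exists_sparse_decoder {p n : ℕ} {D : Matrix (Fin p) (Fin n) ℝ}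
    (hD : ColumnNormalized D) {lam : ℝ}
    (hlam : mutualCoherence D ≠ 0 → lam < 1 / 2 * (1 + 1 / mutualCoherence D)) :
    ∃ f : (Fin p → ℝ) → Fin n → ℝ,
      (∀ (d : ℕ) (G : (Fin d → ℝ) → Fin p → ℝ), (∀ k, ReLUComputable fun y => G y k) →
        ∀ i, ReLUComputable fun y => f (G y) i) ∧
      ∃ C : ℝ, 0 ≤ C ∧ ∀ (y : Fin p → ℝ) (x : Fin n → ℝ), (nnz x : ℝ) ≤ lam →
        ‖f y - x‖ ≤ C * ‖y - D *ᵥ x‖ := by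
  classical
  rcases lt_or_ge lam 0 with hneg | hpos
  · exact ⟨0, fun d G _ i => ReLUComputable.const 0, 0, le_rfl, fun y x hx =>
      absurd (hx.trans_lt hneg) (not_lt.2 (Nat.cast_nonneg _))⟩
  obtain ⟨κ, hκ, hstab⟩ := exists_norm_le_mul_norm_mulVec hD hlam
  let T := {S : Finset (Fin n) // (S.card : ℝ) ≤ lam}
  have hdec : ∀ S : T, ∃ P : (Fin p → ℝ) →ₗ[ℝ] (Fin n → ℝ), (∀ y, ∀ i ∉ S.1, P y i = 0) ∧
      ∀ z : Fin n → ℝ, (∀ i ∉ S.1, z i = 0) → P (D *ᵥ z) = z := by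
    refine fun S => exists_decoder D S.1 fun z hz h0 => ?_
    have h1 : (nnz z : ℝ) ≤ S.1.card := by exact_mod_cast nnz_le_of_support hz
    have h2 := hstab z (by linarith [S.2])
    rw [h0, norm_zero, mul_zero] at h2
    exact norm_le_zero_iff.1 h2
  choose P hPS hP using hdec
  have hne : (Finset.univ : Finset T).Nonempty := ⟨⟨∅, by simpa using hpos⟩, Finset.mem_univ _⟩
  choose c hc0 hc using fun S => exists_norm_linearMap_le (P S)
  let U : T → (Fin p → ℝ) →ₗ[ℝ] (Fin p → ℝ) := fun S => LinearMap.id - D.mulVecLin ∘ₗ P S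
  choose r hr0 hr using fun S => exists_norm_linearMap_le (U S)
  -- The estimate for support `S` is penalized by its residual `U S y = y - D P_S y`, which
  -- outweighs any undershoot caused by a wrong support.
  set F : T → (Fin p → ℝ) → Fin n → ℝ := fun S y i =>
    P S y i + κ * ∑ k, |(U S) y k| with hF
  refine ⟨fun y i => Finset.univ.inf' hne fun S => F S y i, fun d G hG i => ?_,
    κ + ∑ S, (c S + κ * (p * r S)), ?_, fun y x hx => ?_⟩
  · exact ReLUComputable.inf' _ hne fun S => (ReLUComputable.linearMap (P S) i hG).add
      ((ReLUComputable.sum _ fun k => (ReLUComputable.linearMap _ k hG).abs).const_mul κ)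
  · exact add_nonneg hκ (Finset.sum_nonneg fun S _ => add_nonneg (hc0 S)
      (mul_nonneg hκ (mul_nonneg (Nat.cast_nonneg _) (hr0 S))))
  have hterm : ∀ S : T, 0 ≤ c S + κ * (p * r S) := fun S => add_nonneg (hc0 S)
      (mul_nonneg hκ (mul_nonneg (Nat.cast_nonneg _) (hr0 S)))
  set ε := ‖y - D *ᵥ x‖ with hε
  have hε0 : 0 ≤ ε := norm_nonneg _
  have hsum0 : 0 ≤ ∑ S, (c S + κ * (p * r S)) := Finset.sum_nonneg fun S _ => hterm S
  refine (pi_norm_le_iff_of_nonneg (by positivity)).2 fun i => ?_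
  rw [Pi.sub_apply, Real.norm_eq_abs, abs_le]
  constructor
  -- Both `x` and `P S y` are `lam`-sparse, so stability applies to their difference; its image
  -- under `D` is the residual up to the noise.
  · suffices h : x i - κ * ε ≤ Finset.univ.inf' hne fun S => F S y i by
      have : 0 ≤ (∑ S, (c S + κ * (p * r S))) * ε := by positivity
      linarith
    refine Finset.le_inf' _ _ fun S _ => ?_
    have hn : (nnz (x - P S y) : ℝ) ≤ 2 * lam := by
      have h1 : (nnz (x - P S y) : ℝ) ≤ nnz x + nnz (P S y) := by exact_mod_cast nnz_sub_le _ _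
      have h2 : (nnz (P S y) : ℝ) ≤ S.1.card := by exact_mod_cast nnz_le_of_support (hPS S y)
      linarith [S.2]
    have h1 := (norm_le_pi_norm (x - P S y) i).trans (hstab _ hn)
    have h2 : ‖D *ᵥ (x - P S y)‖ ≤ ε + ∑ k, |(U S) y k| := by
      have e : D *ᵥ (x - P S y) =
          (U S) y - (y - D *ᵥ x) := by
        simp [U, Matrix.mulVec_sub]
      rw [e, add_comm]
      exact (norm_sub_le _ _).trans (add_le_add (norm_le_l1norm _) le_rfl)
    have h3 := mul_le_mul_of_nonneg_left h2 hκ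
    have h4 := (le_abs_self _).trans (h1.trans h3)
    simp only [Pi.sub_apply] at h4
    simp only [hF]
    linarith
  -- On the true support `P S` reproduces `x` and `U S` annihilates `D x`, so estimate and penalty
  -- deviate only through the noise.
  · let S₀ : Finset (Fin n) := Finset.univ.filter fun i => x i ≠ 0
    have hS₀ : (S₀.card : ℝ) ≤ lam := by
      refine le_trans (le_of_eq ?_) hx
      rw [nnz, ← Set.ncard_coe_finset]
      simp [S₀]
    let S : T := ⟨S₀, hS₀⟩
    have hxS : ∀ i ∉ S.1, x i = 0 := fun i hi => by simpa [S, S₀] using hi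
    have hPx := hP S x hxS
    have h1 : P S y i - x i ≤ c S * ε := by
      have := (norm_le_pi_norm (P S (y - D *ᵥ x)) i).trans (hc S _)
      rw [map_sub, hPx] at this
      exact (le_abs_self _).trans this
    have h2 : ∑ k, |(U S) y k| ≤ p * (r S * ε) := by
      have e : (U S) y =
          (U S) (y - D *ᵥ x) := by
        simp [U, hPx, Matrix.mulVec_sub]
      refine (l1norm_le_card_mul_norm _).trans ?_
      rw [e]
      gcongr
      exact hr S _
    have h3 : Finset.univ.inf' hne (fun S => F S y i) ≤ F S y i :=
      Finset.inf'_le _ (Finset.mem_univ S)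
    have h4 : c S + κ * (p * r S) ≤ ∑ S, (c S + κ * (p * r S)) :=
      Finset.single_le_sum (f := fun S => c S + κ * (p * r S)) (fun S _ => hterm S)
        (Finset.mem_univ S)
    have h5 := mul_le_mul_of_nonneg_left h2 hκ
    have h6 := mul_le_mul_of_nonneg_right h4 hε0
    have h7 : 0 ≤ κ * ε := by positivity
    have h8 : F S y i = P S y i + κ * ∑ k, |(U S) y k| := rfl
    linarith

/-! ### Decoding all layers -/

/-- Each one-layer decoder is applied to the previous estimate instead of the exact code. That
estimate's error counts as additional noise, and the Lipschitz-type bounds compose. -/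
theorem exists_deep_decoder {J : ℕ} {d : Fin (J + 1) → ℕ}
    (D : (j : Fin J) → Matrix (Fin (d j.castSucc)) (Fin (d j.succ)) ℝ)
    (hD : ∀ j, ColumnNormalized (D j)) (lam : Fin J → ℝ)
    (hlam : ∀ j, mutualCoherence (D j) ≠ 0 → lam j < 1 / 2 * (1 + 1 / mutualCoherence (D j)))
    (j : Fin (J + 1)) :
    ∃ X : (Fin (d 0) → ℝ) → Fin (d j) → ℝ, (∀ i, ReLUComputable fun y => X y i) ∧
      ∃ C : ℝ, 0 ≤ C ∧ ∀ x : (j : Fin (J + 1)) → Fin (d j) → ℝ,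
        (∀ j : Fin J, (nnz (x j.succ) : ℝ) ≤ lam j) →
        ‖X (x 0) - x j‖ ≤
          C * ∑ i : Fin J with i.castSucc < j, ‖x i.castSucc - D i *ᵥ x i.succ‖ := by
  induction j using Fin.induction with
  | zero => exact ⟨fun y => y, ReLUComputable.coord, 0, le_rfl, fun x _ => by simp⟩
  | succ j ih =>
    obtain ⟨X, hX, C, hC, h⟩ := ih
    obtain ⟨f, hf, C', hC', h'⟩ := exists_sparse_decoder (hD j) (hlam j)
    refine ⟨fun y => f (X y), fun i => hf _ X hX i, C' * (C + 1), by positivity, fun x hx => ?_⟩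
    set ε : Fin J → ℝ := fun i => ‖x i.castSucc - D i *ᵥ x i.succ‖ with hε
    have hsplit : (Finset.univ.filter fun i : Fin J => i.castSucc < j.succ) =
        insert j (Finset.univ.filter fun i : Fin J => i.castSucc < j.castSucc) := by
      ext i
      simp only [Finset.mem_filter, Finset.mem_univ, true_and, Finset.mem_insert, Fin.ext_iff,
        Fin.lt_def, Fin.val_castSucc, Fin.val_succ]
      omega
    rw [hsplit, Finset.sum_insert (by simp)]
    have hs0 : 0 ≤ ∑ i : Fin J with i.castSucc < j.castSucc, ε i :=
      Finset.sum_nonneg fun i _ => norm_nonneg _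
    have hj0 : 0 ≤ ε j := norm_nonneg _
    have h1 : ‖X (x 0) - D j *ᵥ x j.succ‖ ≤ ‖X (x 0) - x j.castSucc‖ + ε j :=
      norm_sub_le_norm_sub_add_norm_sub _ _ _
    have h2 := h x hx
    refine (h' _ _ (hx j)).trans ?_
    rw [mul_assoc]
    gcongr
    nlinarith

/-! ### The trivial network and the depth budget -/

/-- The network without hidden layers that returns zero. -/
def zeroNet (s d : ℕ) {J : ℕ} (e : Fin J → ℕ) : MultiOutputCNN s d e where
  toDCNN := programNet s d 0 0 0 0
  tap _ := 0
  tap_le _ := le_rfl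
  outFilter _ _ _ _ := 0
  outBias _ _ := 0

lemma zeroNet_output (s d : ℕ) {J : ℕ} (e : Fin J → ℕ) (ρ : ℝ → ℝ) (y : Fin d → ℝ) (j : Fin J) :
    (zeroNet s d e).output ρ y j = 0 := by
  ext i
  simp [MultiOutputCNN.output, zeroNet]

lemma zeroNet_weights (s d : ℕ) {J : ℕ} (e : Fin J → ℕ) : (zeroNet s d e).weights = 0 := by
  simp [MultiOutputCNN.weights, zeroNet, DCNN.hiddenWeights, programNet, nnz]

/-- Ensures that the logarithmic factor in the depth bound does not fall below 1. For `J = 0` the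
product is empty and its logarithm vanishes. -/
lemma one_le_ceil_logb_prod {J : ℕ} (hJ : 0 < J) {r : Fin J → ℝ} (hr : ∀ j, 2 ≤ r j) {s : ℕ}
    (hs : 2 ≤ s) : 1 ≤ ⌈Real.logb s (∏ j, r j)⌉₊ := by
  refine Nat.one_le_ceil_iff.2 (Real.logb_pos (by exact_mod_cast hs) ?_)
  have h1 : ∏ _j : Fin J, (1 : ℝ) < ∏ j, r j :=
    Finset.prod_lt_prod_of_nonempty (fun _ _ => one_pos) (fun j _ => by linarith [hr j])
      ⟨⟨0, hJ⟩, Finset.mem_univ _⟩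
  simpa using h1

end DeepSparseCoding

end

/-! ### Choice of constants and comparison of `K` with `Q` -/

theorem mainTheorem2 :
    ∃ A : ℝ, 0 < A ∧
    ∀ (J : ℕ) (d : Fin (J + 1) → ℕ) (_ : ∀ j, 1 ≤ d j)
      (D : (j : Fin J) → Matrix (Fin (d j.castSucc)) (Fin (d j.succ)) ℝ)
      (_ : ∀ j, DeepSparseCoding.ColumnNormalized (D j))
      (lam : Fin J → ℝ)
      (_ : ∀ j, DeepSparseCoding.mutualCoherence (D j) ≠ 0 →
        lam j < 1 / 2 * (1 + 1 / DeepSparseCoding.mutualCoherence (D j))),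
    ∃ c : ℝ, 0 < c ∧
    ∀ B : Fin J → ℝ,
    ∃ C : ℝ, 0 < C ∧
    ∀ (ρ : ℝ → ℝ) (β L : ℝ) (_ : DeepSparseCoding.IsGeneralizedReLU ρ β L)
      (m : ℕ) (_ : 1 ≤ m)
      (_ : ∀ j, L < 1 → DeepSparseCoding.genMutualCoherence (D j) ≠ 0 →
        lam j < 1 / (2 - 2 * L ^ m) *
          (1 / DeepSparseCoding.genMutualCoherence (D j) - 2 * L ^ m * (d j.succ : ℝ)))
      (δ : Fin J → ℝ) (s : ℕ) (_ : 2 ≤ s) (K : ℕ) (_ : 1 ≤ K),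
    ∃ N : DeepSparseCoding.MultiOutputCNN s (d 0) (fun j : Fin J => d j.succ),
      (N.depth : ℝ) ≤
        A * m * K * ⌈Real.logb s (∏ j : Fin J, ((d j.castSucc : ℝ) + (d j.succ : ℝ)))⌉₊ ∧
      (N.weights : ℝ) ≤
        A * m * K * ∏ j : Fin J, ((d j.castSucc : ℝ) + (d j.succ : ℝ)) ^ 2 ∧
      ∀ (tol : Fin J → ℝ) (x : (j : Fin (J + 1)) → Fin (d j) → ℝ),
        DeepSparseCoding.IsDeepSparseCoding D lam tol x →
        DeepSparseCoding.BoundedSignalAndNoise D B δ x →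
        ∀ j : Fin J,
          DeepSparseCoding.l2norm (N.output ρ (x 0) j - x j.succ) ≤
            C * Real.exp (-c * K) + C * (∑ i ∈ Finset.Iic j, δ i) + C * β * L ^ (m - 1) := by
  open DeepSparseCoding in
  refine ⟨1, one_pos, fun J d hd D hD lam hlam => ?_⟩
  choose X hX C₀ hC₀ hXC using fun j : Fin J => exists_deep_decoder D hD lam hlam j.succ
  obtain ⟨Q, hQ⟩ := exists_network_approximation (hd 0) hX
  -- The rate is `c = 1`; `Q` is already fixed here, before `B`.
  refine ⟨1, one_pos, fun B => ?_⟩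
  set n : ℝ := ∑ j : Fin J, (d j.succ : ℝ) with hn
  set b : ℝ := ∑ j : Fin J, d j.succ * |B j| with hb
  set Z : ℝ := ∑ j : Fin J, C₀ j with hZ
  have hn0 : 0 ≤ n := Finset.sum_nonneg fun j _ => Nat.cast_nonneg _
  have hb0 : 0 ≤ b := Finset.sum_nonneg fun j _ => by positivity
  have hZ0 : 0 ≤ Z := Finset.sum_nonneg fun j _ => hC₀ j
  have hnj : ∀ j : Fin J, (d j.succ : ℝ) ≤ n := fun j =>
    Finset.single_le_sum (f := fun j : Fin J => (d j.succ : ℝ)) (fun _ _ => Nat.cast_nonneg _)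
      (Finset.mem_univ j)
  have hbj : ∀ j : Fin J, d j.succ * |B j| ≤ b := fun j =>
    Finset.single_le_sum (f := fun j : Fin J => d j.succ * |B j|) (fun _ _ => by positivity)
      (Finset.mem_univ j)
  have hZj : ∀ j : Fin J, C₀ j ≤ Z := fun j =>
    Finset.single_le_sum (f := C₀) (fun j _ => hC₀ j) (Finset.mem_univ j)
  -- The summands serve, in turn, the zero network for `K < Q`, the approximation error, the
  -- propagated noise, and positivity.
  set C : ℝ := b * Real.exp Q + n + n * Z + 1 with hC
  have hCpos : 0 < C := by positivity
  have hCb : b * Real.exp Q ≤ C := by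
    have : 0 ≤ n * Z := by positivity
    linarith
  have hCn : n ≤ C := by
    have : 0 ≤ n * Z := by positivity
    have : 0 ≤ b * Real.exp Q := by positivity
    linarith
  have hCZ : n * Z ≤ C := by
    have : 0 ≤ b * Real.exp Q := by positivity
    linarith
  refine ⟨C, hCpos, fun ρ β L hρ m hm _ δ s hs K hK => ?_⟩
  have hthird : 0 ≤ C * β * L ^ (m - 1) :=
    mul_nonneg (mul_nonneg hCpos.le hρ.bound_nonneg) (pow_nonneg hρ.lipschitz_nonneg _)
  -- The sign of `δ` is not prescribed, but the existence of admissible codes forces it.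
  have hδ0 : ∀ x : (j : Fin (J + 1)) → Fin (d j) → ℝ, BoundedSignalAndNoise D B δ x →
      ∀ j, 0 ≤ δ j := fun x hx j =>
    (Finset.sum_nonneg fun i _ => abs_nonneg _).trans (hx j).2
  have hm' : (1 : ℝ) ≤ m := by exact_mod_cast hm
  have hdim : ∀ j : Fin J, (2 : ℝ) ≤ (d j.castSucc : ℝ) + d j.succ := fun j => by
    have h1 : (1 : ℝ) ≤ d j.castSucc := by exact_mod_cast hd _
    have h2 : (1 : ℝ) ≤ d j.succ := by exact_mod_cast hd _
    linarith
  rcases lt_or_ge K Q with hKQ | hKQ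
  · refine ⟨zeroNet s (d 0) _, ?_, ?_, fun tol x _ hx j => ?_⟩
    · simp only [zeroNet, programNet, Nat.cast_zero]
      positivity
    · rw [zeroNet_weights, Nat.cast_zero]
      positivity
    · have h1 : l2norm ((zeroNet s (d 0) fun j : Fin J => d j.succ).output ρ (x 0) j - x j.succ)
          ≤ b := by
        rw [zeroNet_output, zero_sub]
        refine (l2norm_le_l1norm _).trans (le_trans ?_ (hbj j))
        refine (Finset.sum_le_card_nsmul _ _ |B j| fun i _ => ?_).trans (by simp)
        rw [Pi.neg_apply, abs_neg]
        exact ((hx j).1 i).trans (le_abs_self _)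
      have h2 : b ≤ C * Real.exp (-1 * K) := by
        calc b ≤ b * Real.exp (Q + -1 * K) := by
              refine le_mul_of_one_le_right hb0 (Real.one_le_exp ?_)
              have : (K : ℝ) ≤ Q := by exact_mod_cast hKQ.le
              linarith
          _ = b * Real.exp Q * Real.exp (-1 * K) := by rw [Real.exp_add]; ring
          _ ≤ C * Real.exp (-1 * K) := by gcongr
      have h3 : 0 ≤ C * ∑ i ∈ Finset.Iic j, δ i :=
        mul_nonneg hCpos.le (Finset.sum_nonneg fun i _ => hδ0 x hx i)
      linarith
  · rcases Nat.eq_zero_or_pos J with rfl | hJ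
    -- For `J = 0` the depth bound is zero, so a network without layers is required.
    · refine ⟨zeroNet s (d 0) _, ?_, ?_, fun tol x _ hx j => j.elim0⟩
      · simp only [zeroNet, programNet, Nat.cast_zero]
        positivity
      · rw [zeroNet_weights, Nat.cast_zero]
        positivity
    let j₀ : Fin J := ⟨0, hJ⟩
    -- Only the summand of the first dictionary matters: the observation is `D₁ x₁` plus noise,
    -- hence bounded in terms of `B` and `δ`. The network may depend on `R`, but its size does not.
    set R : ℝ := ∑ j : Fin J, (|δ j| + l1norm (fun i => ∑ k, |D j i k| * |B j|)) with hR
    obtain ⟨N, hNd, hNw, hN⟩ := hQ ρ β L hρ s hs R (Real.exp (-1 * K)) (Real.exp_pos _)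
    have hQK : (Q : ℝ) ≤ 1 * m * K := by
      have h1 : (Q : ℝ) ≤ K := by exact_mod_cast hKQ
      have h2 : (0 : ℝ) ≤ K := Nat.cast_nonneg K
      nlinarith
    refine ⟨N, ?_, ?_, fun tol x hx hxB j => ?_⟩
    · have h1 : (N.depth : ℝ) ≤ Q := by exact_mod_cast hNd
      refine (h1.trans hQK).trans (le_mul_of_one_le_right (by positivity) ?_)
      exact_mod_cast one_le_ceil_logb_prod hJ hdim hs
    · have h1 : (N.weights : ℝ) ≤ Q := by exact_mod_cast hNw
      refine (h1.trans hQK).trans (le_mul_of_one_le_right (by positivity) ?_)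
      have h2 : ∏ _j : Fin J, (1 : ℝ) ≤ ∏ j : Fin J, ((d j.castSucc : ℝ) + d j.succ) ^ 2 :=
        Finset.prod_le_prod (fun _ _ => zero_le_one) fun j _ =>
          one_le_pow₀ (by linarith [hdim j])
      simpa using h2
    · have hbox : ∀ i, |x 0 i| ≤ R := by
        intro i
        have h1 : |x 0 i| ≤ |δ j₀| + l1norm (fun i => ∑ k, |D j₀ i k| * |B j₀|) := by
          have e : x j₀.castSucc = (x j₀.castSucc - D j₀ *ᵥ x j₀.succ) + D j₀ *ᵥ x j₀.succ := by
            simp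
          have h2 : ‖x j₀.castSucc‖ ≤ |δ j₀| + l1norm (fun i => ∑ k, |D j₀ i k| * |B j₀|) := by
            rw [e]
            refine (norm_add_le _ _).trans (add_le_add ?_ ?_)
            · exact (norm_le_l1norm _).trans ((hxB j₀).2.trans (le_abs_self _))
            · refine (norm_le_l1norm _).trans (Finset.sum_le_sum fun i _ => ?_)
              refine le_trans ?_ (le_abs_self _)
              simp only [Matrix.mulVec, dotProduct]
              refine (Finset.abs_sum_le_sum_abs _ _).trans (Finset.sum_le_sum fun k _ => ?_)
              rw [abs_mul]
              exact mul_le_mul_of_nonneg_left (((hxB j₀).1 k).trans (le_abs_self _)) (abs_nonneg _)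
          exact (norm_le_pi_norm (x j₀.castSucc) i).trans h2
        refine h1.trans (Finset.single_le_sum (f := fun j : Fin J =>
          |δ j| + l1norm (fun i => ∑ k, |D j i k| * |B j|)) (fun j _ => ?_) (Finset.mem_univ j₀))
        exact add_nonneg (abs_nonneg _) (Finset.sum_nonneg fun _ _ => abs_nonneg _)
      have hΔ0 : 0 ≤ ∑ i ∈ Finset.Iic j, δ i := Finset.sum_nonneg fun i _ => hδ0 x hxB i
      have h1 : ‖X j (x 0) - x j.succ‖ ≤ Z * ∑ i ∈ Finset.Iic j, δ i := by
        refine (hXC j x fun j => (hx j).2).trans ?_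
        have hs : (Finset.univ.filter fun i : Fin J => i.castSucc < j.succ) = Finset.Iic j := by
          ext i
          simp [Fin.castSucc_lt_succ_iff]
        rw [hs]
        refine mul_le_mul (hZj j) (Finset.sum_le_sum fun i _ =>
          (norm_le_l1norm _).trans (hxB i).2) (Finset.sum_nonneg fun _ _ => norm_nonneg _) hZ0
      have h2 : l2norm (N.output ρ (x 0) j - x j.succ) ≤
          n * (Real.exp (-1 * K) + Z * ∑ i ∈ Finset.Iic j, δ i) := by
        refine (l2norm_le_l1norm _).trans ?_
        refine (Finset.sum_le_card_nsmul _ _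
          (Real.exp (-1 * K) + Z * ∑ i ∈ Finset.Iic j, δ i) fun i _ => ?_).trans ?_
        · refine (abs_sub_le _ (X j (x 0) i) _).trans (add_le_add (hN _ hbox j i) ?_)
          exact (norm_le_pi_norm (X j (x 0) - x j.succ) i).trans h1
        · rw [Finset.card_univ, Fintype.card_fin, nsmul_eq_mul]
          exact mul_le_mul_of_nonneg_right (hnj j) (by positivity)
      have h3 : n * Real.exp (-1 * K) ≤ C * Real.exp (-1 * K) := by gcongr
      have h4 : n * Z * ∑ i ∈ Finset.Iic j, δ i ≤ C * ∑ i ∈ Finset.Iic j, δ i := by gcongr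
      linarith
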